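/- Let $S$ be an integral domain that is not a field, let $F$ be its field of fractions, and let $A$ be an associative unital $F$-algebra, not necessarily commutative, with $F \subseteq A$ and $A \neq F$. A basis $B$ of $A$ over $F$ is called $S$-stable if there is a basis $C$ of $A$ over $F$ such that $cb \in \sum_{y \in B} Sy$ for all $c \in C$ and $b \in B$. A prime ideal of a ring $R$ is a proper two-sided ideal $P$ such that for all two-sided ideals $I, J$ of $R$, $IJ \subseteq P$ implies $I \subseteq P$ or $J \subseteq P$. If $R$ is an $S$-subalgebra of $A$, a chain $\mathcal E$ of prime ideals of $R$ (with respect to inclusion) is said to cover a chain $\mathcal C$ of prime ideals of $S$ if for every $P \in \mathcal C$ there is $Q \in \mathcal E$ with $Q \cap S = P$. Assume that there exists an $S$-stable basis of $A$ over $F$, and let $\mathcal C$ be a chain of prime ideals of $S$. Then there exists an $S$-subalgebra $R$ of $A$ such that $RF = A$ and such that some chain $\mathcal E$ of prime ideals of $R$ covers $\mathcal C$. Moreover, there exists an infinite strictly descending chain $R_0 \supsetneq R_1 \supsetneq R_2 \supsetneq \cdots$ of $S$-subalgebras of $A$, each of which satisfies $R_n F = A$ and has a chain of prime ideals covering $\mathcal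 C$. -/

import Mathlib

namespace StableBasis

universe u v w

/-- `B` is a basis (as a set of vectors) of the algebra `A` over the field `F`. -/
def IsBasisSet (F : Type v) {A : Type w} [Field F] [Ring A] [Algebra F A] (B : Set A) : Prop :=
  LinearIndepOn F id B ∧ Submodule.span F B = ⊤

/-- `B` is an `S`-stable basis of `A` over `F`: it is a basis, and there is a basis `C` of `A`
over `F` such that `c * b ∈ ∑_{y ∈ B} S y` for all `c ∈ C` and `b ∈ B`. -/
def IsStableBasis (S : Type u) (F : Type v) {A : Type w} [CommRing S] [Field F] [Ring A]
    [Algebra S A] [Algebra F A] (B : Set A) : Prop :=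
  IsBasisSet F B ∧
    ∃ C : Set A, IsBasisSet F C ∧ ∀ c ∈ C, ∀ b ∈ B, c * b ∈ Submodule.span S B

/-- Prime ideals of a ring that need not be commutative: proper two-sided ideals `P` such that
`I J ⊆ P` implies `I ⊆ P` or `J ⊆ P` for all two-sided ideals `I`, `J`. -/
def IsPrimeTwoSided {R : Type w} [Ring R] (P : TwoSidedIdeal R) : Prop :=
  P ≠ ⊤ ∧ ∀ I J : TwoSidedIdeal R, (∀ a ∈ I, ∀ b ∈ J, a * b ∈ P) → I ≤ P ∨ J ≤ P

/-- `Q` lies over `P`, that is, `Q ∩ S = P`. -/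
def LiesOver {S : Type u} {R : Type w} [CommRing S] [Ring R] [Algebra S R]
    (Q : TwoSidedIdeal R) (P : PrimeSpectrum S) : Prop :=
  ∀ s : S, algebraMap S R s ∈ Q ↔ s ∈ P.asIdeal

/-- Some chain of prime ideals of `R` covers the set `C` of prime ideals of `S`. -/
def HasCoveringChain {S : Type u} (R : Type w) [CommRing S] [Ring R] [Algebra S R]
    (C : Set (PrimeSpectrum S)) : Prop :=
  ∃ E : Set (TwoSidedIdeal R), IsChain (· ≤ ·) E ∧ (∀ Q ∈ E, IsPrimeTwoSided Q) ∧
    ∀ P ∈ C, ∃ Q ∈ E, LiesOver Q P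

end StableBasis

/-! The primes in `C` are first made contractions of primes of one valuation ring `V` of `F`. It
suffices that `V` contains `S` and that every `p / s` with `p ∈ P`, `s ∉ P`, `P ∈ C` is a nonunit of
`V` (`exists_valuationSubring_of_chain`, `exists_prime_over_of_chainQuotients`).

Let `L` be the `V`-lattice of a stable basis. Its left multiplier ring `{a | a L ⊆ L}` contains the
companion basis, hence spans `A`. In any `V`-order preserving `L`, the maximal ideal of `V`
generates a proper ideal. Over a valuation ring this and torsion-freeness already force one chain of
primes to lie over all of `Spec V` (`exists_chain_over_valuationRing`).

An order preserving `L` can always be shrunk to a strictly smaller one of the same kind, since `A ≠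
F` and `V` has a nonzero nonunit (`IsLatticeOrder.exists_lt`); iteration gives the descending
sequence. -/

namespace StableBasis

/-! ### Prime ideals of noncommutative rings. -/

/-- Elementwise form of primeness. -/
theorem IsPrimeTwoSided.mem_or_mem {R : Type*} [Ring R] {P : TwoSidedIdeal R}
    (hP : IsPrimeTwoSided P) {a b : R} (h : ∀ x, a * x * b ∈ P) : a ∈ P ∨ b ∈ P := by
  -- `I = {y | y R b ⊆ P}` and `J = {z | I z ⊆ P}` are two-sided with `I J ⊆ P`, which avoids
  -- computing with generated ideals.
  let I : TwoSidedIdeal R := .mk' {y | ∀ x, y * x * b ∈ P}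
    (fun x => by simp [P.zero_mem])
    (fun {y z} hy hz x => by rw [add_mul, add_mul]; exact P.add_mem (hy x) (hz x))
    (fun {y} hy x => by rw [neg_mul, neg_mul]; exact P.neg_mem (hy x))
    (fun {y z} hz x => by
      rw [mul_assoc y, mul_assoc y]; exact P.mul_mem_left _ _ (hz x))
    (fun {y z} hy x => by rw [mul_assoc y]; exact hy _)
  let J : TwoSidedIdeal R := .mk' {z | ∀ y ∈ I, y * z ∈ P}
    (fun x _ => by simp [P.zero_mem])
    (fun {y z} hy hz x hx => by rw [mul_add]; exact P.add_mem (hy x hx) (hz x hx))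
    (fun {y} hy x hx => by rw [mul_neg]; exact P.neg_mem (hy x hx))
    (fun {y z} hz x hx => by rw [← mul_assoc]; exact hz _ (I.mul_mem_right _ _ hx))
    (fun {y z} hy x hx => by rw [← mul_assoc]; exact P.mul_mem_right _ _ (hy x hx))
  have hI : a ∈ I := by rw [TwoSidedIdeal.mem_mk']; exact h
  have hJ : b ∈ J := by
    rw [TwoSidedIdeal.mem_mk']
    intro y hy
    rw [TwoSidedIdeal.mem_mk'] at hy
    simpa using hy 1
  rcases hP.2 I J (fun y hy z hz => by
    rw [TwoSidedIdeal.mem_mk'] at hz; exact hz y hy) with h | h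
  · exact Or.inl (h hI)
  · exact Or.inr (h hJ)

/-- An ideal disjoint from an `m`-system is contained in a prime ideal disjoint from it. -/
theorem exists_prime_disjoint {R : Type*} [Ring R] (T : Set R) (hne : T.Nonempty)
    (hT : ∀ a ∈ T, ∀ b ∈ T, ∃ x, a * x * b ∈ T) (K : TwoSidedIdeal R)
    (hK : ∀ t ∈ T, t ∉ K) :
    ∃ Q : TwoSidedIdeal R, IsPrimeTwoSided Q ∧ K ≤ Q ∧ ∀ t ∈ T, t ∉ Q := by
  obtain ⟨Q, hKQ, hQ⟩ := zorn_le_nonempty₀ {Q : TwoSidedIdeal R | ∀ t ∈ T, t ∉ Q} (by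
    intro c hc hchain y hy
    let U : TwoSidedIdeal R := .mk' {x | ∃ Q ∈ c, x ∈ Q}
      ⟨y, hy, y.zero_mem⟩
      (by
        rintro a b ⟨Q₁, h₁, ha⟩ ⟨Q₂, h₂, hb⟩
        rcases hchain.total h₁ h₂ with h | h
        · exact ⟨Q₂, h₂, Q₂.add_mem (h ha) hb⟩
        · exact ⟨Q₁, h₁, Q₁.add_mem ha (h hb)⟩)
      (by rintro a ⟨Q, h, ha⟩; exact ⟨Q, h, Q.neg_mem ha⟩)
      (by rintro a b ⟨Q, h, hb⟩; exact ⟨Q, h, Q.mul_mem_left _ _ hb⟩)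
      (by rintro a b ⟨Q, h, ha⟩; exact ⟨Q, h, Q.mul_mem_right _ _ ha⟩)
    refine ⟨U, ?_, ?_⟩
    · intro t ht htU
      rw [TwoSidedIdeal.mem_mk'] at htU
      obtain ⟨Q, h, htQ⟩ := htU
      exact hc h t ht htQ
    · intro Q hQ x hx
      rw [TwoSidedIdeal.mem_mk']
      exact ⟨Q, hQ, hx⟩) K hK
  have key : ∀ I : TwoSidedIdeal R, ¬ I ≤ Q → ∃ t ∈ T, t ∈ Q ⊔ I := by
    intro I hI
    by_contra! hcon
    exact hI (le_sup_right.trans (hQ.2 hcon le_sup_left))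
  refine ⟨Q, ⟨?_, ?_⟩, hKQ, hQ.1⟩
  · rintro rfl
    obtain ⟨t, ht⟩ := hne
    exact hQ.1 t ht (TwoSidedIdeal.mem_top _)
  · intro I J hIJ
    by_contra! hcon
    obtain ⟨t₁, ht₁, h₁⟩ := key I hcon.1
    obtain ⟨t₂, ht₂, h₂⟩ := key J hcon.2
    obtain ⟨x, hx⟩ := hT t₁ ht₁ t₂ ht₂
    refine hQ.1 _ hx ?_
    obtain ⟨q₁, hq₁, i, hi, rfl⟩ := TwoSidedIdeal.mem_sup.1 h₁
    obtain ⟨q₂, hq₂, j, hj, rfl⟩ := TwoSidedIdeal.mem_sup.1 h₂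
    have : (q₁ + i) * x * (q₂ + j) = q₁ * (x * (q₂ + j)) + (i * x * q₂ + i * x * j) := by
      noncomm_ring
    rw [this]
    exact Q.add_mem (Q.mul_mem_right _ _ hq₁)
      (Q.add_mem (Q.mul_mem_left _ _ hq₂) (hIJ _ (I.mul_mem_right _ _ hi) _ hj))

/-! ### Chains of primes over a valuation ring. -/

/-- A torsion-free algebra over a valuation ring in which the maximal ideal does not generate
the unit ideal has a chain of prime ideals lying over all primes of the valuation ring. -/
theorem exists_chain_over_valuationRing {O R : Type*} [CommRing O] [IsDomain O] [ValuationRing O]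
    [Ring R] [Algebra O R] (htf : ∀ (s : O) (r : R), s • r = 0 → s = 0 ∨ r = 0)
    (m : TwoSidedIdeal R) (hm : m ≠ ⊤) (hmO : ∀ a : O, ¬ IsUnit a → algebraMap O R a ∈ m) :
    ∃ E : Set (TwoSidedIdeal R), IsChain (· ≤ ·) E ∧ (∀ Q ∈ E, IsPrimeTwoSided Q) ∧
      ∀ P : PrimeSpectrum O, ∃ Q ∈ E, LiesOver Q P := by
  obtain ⟨Qm, hQm, hmQm, -⟩ := exists_prime_disjoint {1} ⟨1, rfl⟩
    (by rintro a rfl b rfl; exact ⟨1, by simp⟩) m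
    (by rintro t rfl; rwa [TwoSidedIdeal.one_mem_iff])
  -- A single maximal chain through `Qm` serves every `P`: a prime over `P` comparable with all its
  -- members must belong to it.
  obtain ⟨E, hE, hQmE⟩ := IsChain.exists_maxChain (r := (· ≤ ·))
    (c := {(⟨Qm, hQm⟩ : {Q : TwoSidedIdeal R // IsPrimeTwoSided Q})})
    Set.subsingleton_singleton.isChain
  rw [Set.singleton_subset_iff] at hQmE
  refine ⟨Subtype.val '' E, ?_, ?_, ?_⟩
  · rintro _ ⟨Q, hQ, rfl⟩ _ ⟨Q', hQ', rfl⟩ _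
    exact hE.1.total hQ hQ'
  · rintro _ ⟨Q, hQ, rfl⟩
    exact Q.2
  intro P
  have dvd_P : ∀ p ∈ P.asIdeal, ∀ s ∉ P.asIdeal, ∃ q ∈ P.asIdeal, p = s * q := by
    intro p hp s hs
    rcases ValuationRing.dvd_total s p with ⟨q, rfl⟩ | ⟨q, rfl⟩
    · exact ⟨q, (P.2.mem_or_mem hp).resolve_left hs, rfl⟩
    · exact absurd (P.asIdeal.mul_mem_right q hp) hs
  -- `P` cuts `E` in two: `I` is the intersection of the upper part, `L` the lower part. Adjoining
  -- `⊥`, which need not be prime, keeps `L` nonempty; torsion-freeness replaces primeness for it in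
  -- `hLcancel`.
  let Above : TwoSidedIdeal R → Prop := fun Q => ∀ p ∈ P.asIdeal, algebraMap O R p ∈ Q
  let I : TwoSidedIdeal R := sInf {Q | Above Q ∧ ∃ h, (⟨Q, h⟩ : Subtype _) ∈ E}
  let L : Set (TwoSidedIdeal R) :=
    insert ⊥ {Q | ¬ Above Q ∧ ∃ h, (⟨Q, h⟩ : {Q : TwoSidedIdeal R // IsPrimeTwoSided Q}) ∈ E}
  have hIm : I ≤ Qm := sInf_le ⟨fun p hp => hmQm (hmO p fun hu =>
    P.2.ne_top (Ideal.eq_top_of_isUnit_mem _ hp hu)), hQm, hQmE⟩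
  have h1I : (1 : R) ∉ I := fun h => hQm.1 ((TwoSidedIdeal.one_mem_iff _).1 (hIm h))
  have hI_msys : ∀ a b : R, a ∉ I → b ∉ I → ∃ x, a * x * b ∉ I := by
    intro a b ha hb
    simp only [I, TwoSidedIdeal.mem_sInf, not_forall] at ha hb
    obtain ⟨Q₁, ⟨h₁, hp₁, hE₁⟩, ha⟩ := ha
    obtain ⟨Q₂, ⟨h₂, hp₂, hE₂⟩, hb⟩ := hb
    have aux : ∀ Q : TwoSidedIdeal R, Above Q → ∀ h : IsPrimeTwoSided Q,
        (⟨Q, h⟩ : Subtype _) ∈ E → a ∉ Q → b ∉ Q → ∃ x, a * x * b ∉ I := by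
      intro Q hQ hpQ hQE ha hb
      by_contra! hcon
      rcases hpQ.mem_or_mem (fun x => (sInf_le (show Q ∈ _ from ⟨hQ, hpQ, hQE⟩) : I ≤ Q) (hcon x))
        with h | h
      · exact ha h
      · exact hb h
    rcases hE.1.total hE₁ hE₂ with h | h
    · exact aux Q₁ h₁ hp₁ hE₁ ha fun hb' => hb (h hb')
    · exact aux Q₂ h₂ hp₂ hE₂ (fun ha' => ha (h ha')) hb
  have hLI : ∀ Q ∈ L, Q ≤ I := by
    rintro Q (rfl | ⟨hQ, hpQ, hQE⟩)
    · exact bot_le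
    · refine le_sInf ?_
      rintro Q' ⟨hQ', hpQ', hQE'⟩
      rcases hE.1.total hQE hQE' with h | h
      · exact h
      · exact absurd (fun p hp => h (hQ' p hp)) hQ
  have hLtotal : ∀ Q₁ ∈ L, ∀ Q₂ ∈ L, Q₁ ≤ Q₂ ∨ Q₂ ≤ Q₁ := by
    rintro Q₁ (rfl | ⟨-, h₁, hE₁⟩) Q₂ (rfl | ⟨-, h₂, hE₂⟩)
    · exact Or.inl le_rfl
    · exact Or.inl bot_le
    · exact Or.inr bot_le
    · exact hE.1.total hE₁ hE₂
  have hLcancel : ∀ Q ∈ L, ∀ s ∉ P.asIdeal, ∀ x : R, s • x ∈ Q → x ∈ Q := by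
    rintro Q (rfl | ⟨hQ, hpQ, hQE⟩) s hs x hx
    · refine (htf s x hx).resolve_left ?_
      rintro rfl
      exact hs P.asIdeal.zero_mem
    · simp only [Above, not_forall] at hQ
      obtain ⟨p, hp, hpn⟩ := hQ
      refine (hpQ.mem_or_mem (a := algebraMap O R s) fun r => ?_).resolve_left fun hsQ => ?_
      · rw [Algebra.commutes, mul_assoc, ← Algebra.smul_def]
        exact Q.mul_mem_left _ _ hx
      · obtain ⟨q, -, rfl⟩ := dvd_P p hp s hs
        rw [map_mul] at hpn
        exact hpn (Q.mul_mem_right _ _ hsQ)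
  -- `K = P R + ⋃ L`. Divisibility in `O` lets a single `p • r` stand for any element of `P R`.
  let K : TwoSidedIdeal R := .mk' {x | ∃ p ∈ P.asIdeal, ∃ r : R, ∃ Q ∈ L, x - p • r ∈ Q}
    ⟨0, P.asIdeal.zero_mem, 0, ⊥, Set.mem_insert _ _, by simp⟩
    (by
      rintro x y ⟨p, hp, r, Q, hQ, hx⟩ ⟨p', hp', r', Q', hQ', hy⟩
      obtain ⟨Q'', hQ'', hx, hy⟩ : ∃ Q'' ∈ L, x - p • r ∈ Q'' ∧ y - p' • r' ∈ Q'' := by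
        rcases hLtotal Q hQ Q' hQ' with h | h
        · exact ⟨Q', hQ', h hx, hy⟩
        · exact ⟨Q, hQ, hx, h hy⟩
      have := Q''.add_mem hx hy
      rcases ValuationRing.dvd_total p p' with ⟨q, rfl⟩ | ⟨q, rfl⟩
      · refine ⟨p, hp, r + q • r', Q'', hQ'', ?_⟩
        convert this using 1
        rw [smul_add, mul_smul]; abel
      · refine ⟨p', hp', q • r + r', Q'', hQ'', ?_⟩
        convert this using 1
        rw [smul_add, mul_smul]; abel)
    (by
      rintro x ⟨p, hp, r, Q, hQ, hx⟩
      refine ⟨p, hp, -r, Q, hQ, ?_⟩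
      convert Q.neg_mem hx using 1
      rw [smul_neg]; abel)
    (by
      rintro y x ⟨p, hp, r, Q, hQ, hx⟩
      refine ⟨p, hp, y * r, Q, hQ, ?_⟩
      convert Q.mul_mem_left y _ hx using 1
      rw [mul_sub, mul_smul_comm])
    (by
      rintro x y ⟨p, hp, r, Q, hQ, hx⟩
      refine ⟨p, hp, r * y, Q, hQ, ?_⟩
      convert Q.mul_mem_right _ y hx using 1
      rw [sub_mul, smul_mul_assoc])
  -- Avoiding all `s • r` with `s ∉ P`, `r ∉ I` forces both `Q ≤ I` (take `s = 1`) and `Q ∩ O ⊆ P`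
  -- (take `r = 1`).
  obtain ⟨Q, hQ, hKQ, hQT⟩ := exists_prime_disjoint
    {t : R | ∃ s ∉ P.asIdeal, ∃ r ∉ I, t = s • r}
    ⟨1, 1, P.asIdeal.ne_top_iff_one.1 P.2.ne_top, 1, h1I, by simp⟩
    (by
      rintro _ ⟨s, hs, r, hr, rfl⟩ _ ⟨s', hs', r', hr', rfl⟩
      obtain ⟨x, hx⟩ := hI_msys r r' hr hr'
      refine ⟨x, s * s', fun h => (P.2.mem_or_mem h).elim hs hs', _, hx, ?_⟩
      simp only [smul_mul_assoc, mul_smul_comm, mul_smul]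
      rw [smul_comm])
    K
    (by
      rintro _ ⟨s, hs, r, hr, rfl⟩ hK
      rw [TwoSidedIdeal.mem_mk'] at hK
      obtain ⟨p, hp, r', Q', hQ', hx⟩ := hK
      -- Writing `p = s * q` with `q ∈ P`, the factor `s` cancels modulo `Q'`, so `r - q • r' ∈ I`;
      -- as `q • r' ∈ I`, also `r ∈ I`.
      obtain ⟨q, hq, rfl⟩ := dvd_P p hp s hs
      rw [mul_smul, ← smul_sub] at hx
      have hmem := hLI Q' hQ' (hLcancel Q' hQ' s hs _ hx)
      have hqI : q • r' ∈ I := by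
        rw [TwoSidedIdeal.mem_sInf]
        rintro Q'' ⟨hQ'', -⟩
        rw [Algebra.smul_def]
        exact Q''.mul_mem_right _ _ (hQ'' q hq)
      exact hr (by simpa using I.add_mem hmem hqI))
  have hQI : Q ≤ I := by
    intro x hx
    by_contra hxI
    exact hQT x ⟨1, P.asIdeal.ne_top_iff_one.1 P.2.ne_top, x, hxI, by simp⟩ hx
  have hLQ : ∀ Q' ∈ L, Q' ≤ Q := fun Q' hQ' x hx => hKQ (by
    rw [TwoSidedIdeal.mem_mk']
    exact ⟨0, P.asIdeal.zero_mem, 0, Q', hQ', by simpa using hx⟩)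
  refine ⟨Q, ⟨⟨Q, hQ⟩, ?_, rfl⟩, ?_⟩
  · have hins : IsChain (· ≤ ·)
        (insert (⟨Q, hQ⟩ : {Q : TwoSidedIdeal R // IsPrimeTwoSided Q}) E) := by
      refine hE.1.insert ?_
      rintro ⟨Q', hpQ'⟩ hQ'E -
      by_cases hA : Above Q'
      · exact Or.inl (hQI.trans (sInf_le ⟨hA, hpQ', hQ'E⟩))
      · exact Or.inr (hLQ Q' (Or.inr ⟨hA, hpQ', hQ'E⟩))
    rw [hE.2 hins (Set.subset_insert _ _)]
    exact Set.mem_insert _ _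
  · intro s
    constructor
    · intro hsQ
      by_contra hs
      exact hQT _ ⟨s, hs, 1, h1I, by rw [Algebra.smul_def, mul_one]⟩ hsQ
    · intro hs
      refine hKQ ?_
      rw [TwoSidedIdeal.mem_mk']
      exact ⟨s, hs, 1, ⊥, Set.mem_insert _ _, by simp [Algebra.smul_def]⟩

/-! ### A valuation ring adapted to a chain of primes. -/

/-- Induction removes the largest prime `P`. If `N` serves the smaller primes, then `N ∩ S ⊆ P`, and
the localization of `P + N` at `P` serves all of them: `s' * s - p ∈ N` with `s' ∉ P`, `p ∈ P` gives
`s' * s ∈ P`, so `s ∈ P`. -/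
theorem exists_nonUnitalSubalgebra_of_finset {S F : Type*} [CommRing S] [IsDomain S] [Field F]
    [Algebra S F] [IsFractionRing S F] (t : Finset (PrimeSpectrum S))
    (ht : IsChain (· ≤ ·) (t : Set (PrimeSpectrum S))) :
    ∃ N : NonUnitalSubalgebra S F,
      (∀ P ∈ t, ∀ p ∈ P.asIdeal, ∀ s ∉ P.asIdeal, algebraMap S F p / algebraMap S F s ∈ N) ∧
      ∀ s : S, algebraMap S F s ∈ N → s = 0 ∨ ∃ P ∈ t, s ∈ P.asIdeal := by
  classical
  induction t using Finset.strongInduction with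
  | H t ih =>
    rcases t.eq_empty_or_nonempty with rfl | hne
    · refine ⟨⊥, by simp, fun s hs => Or.inl ?_⟩
      rw [NonUnitalAlgebra.mem_bot] at hs
      exact (map_eq_zero_iff _ (IsFractionRing.injective S F)).1 hs
    obtain ⟨P, hPt, hP⟩ := t.exists_maximal hne
    have hmax : ∀ P' ∈ t, P' ≤ P := fun P' hP' =>
      (ht.total hP' hPt).elim id fun h => hP hP' h
    obtain ⟨N, hN, hNS⟩ := ih (t.erase P) (Finset.erase_ssubset hPt)
      (ht.mono (by simp))
    have hNP : ∀ s : S, algebraMap S F s ∈ N → s ∈ P.asIdeal := by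
      intro s hs
      rcases hNS s hs with rfl | ⟨P', hP', h⟩
      · exact P.asIdeal.zero_mem
      · exact hmax P' (Finset.mem_of_mem_erase hP') h
    have h1 : (1 : S) ∉ P.asIdeal := P.asIdeal.ne_top_iff_one.1 P.2.ne_top
    let N' : NonUnitalSubalgebra S F :=
      { carrier := {x | ∃ s ∉ P.asIdeal, ∃ p ∈ P.asIdeal, ∃ y ∈ N,
          algebraMap S F s * x = algebraMap S F p + y}
        zero_mem' := ⟨1, h1, 0, P.asIdeal.zero_mem, 0, N.zero_mem, by simp⟩
        add_mem' := by
          rintro x x' ⟨s, hs, p, hp, y, hy, h⟩ ⟨s', hs', p', hp', y', hy', h'⟩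
          refine ⟨s * s', fun h => (P.2.mem_or_mem h).elim hs hs', s' * p + s * p',
            P.asIdeal.add_mem (P.asIdeal.mul_mem_left _ hp) (P.asIdeal.mul_mem_left _ hp'),
            s' • y + s • y', N.add_mem (N.smul_mem _ hy) (N.smul_mem _ hy'), ?_⟩
          simp only [map_mul, map_add, Algebra.smul_def]
          linear_combination algebraMap S F s' * h + algebraMap S F s * h'
        mul_mem' := by
          rintro x x' ⟨s, hs, p, hp, y, hy, h⟩ ⟨s', hs', p', hp', y', hy', h'⟩
          refine ⟨s * s', fun h => (P.2.mem_or_mem h).elim hs hs', p * p',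
            P.asIdeal.mul_mem_left _ hp',
            p • y' + p' • y + y * y',
            N.add_mem (N.add_mem (N.smul_mem _ hy') (N.smul_mem _ hy)) (N.mul_mem hy hy'), ?_⟩
          simp only [map_mul, Algebra.smul_def]
          linear_combination algebraMap S F s' * x' * h + (algebraMap S F p + y) * h'
        smul_mem' := by
          rintro c x ⟨s, hs, p, hp, y, hy, h⟩
          refine ⟨s, hs, c * p, P.asIdeal.mul_mem_left _ hp, c • y, N.smul_mem _ hy, ?_⟩
          simp only [map_mul, Algebra.smul_def]
          linear_combination algebraMap S F c * h }
    refine ⟨N', fun P' hP' p hp s hs => ?_, fun s hs => Or.inr ⟨P, hPt, ?_⟩⟩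
    · by_cases hPP : P' = P
      · subst hPP
        have hs0 : algebraMap S F s ≠ 0 := by
          rw [Ne, map_eq_zero_iff _ (IsFractionRing.injective S F)]
          rintro rfl
          exact hs P'.asIdeal.zero_mem
        exact ⟨s, hs, p, hp, 0, N.zero_mem, by rw [mul_div_cancel₀ _ hs0, add_zero]⟩
      · exact ⟨1, h1, 0, P.asIdeal.zero_mem, _,
          hN P' (Finset.mem_erase.2 ⟨hPP, hP'⟩) p hp s hs, by simp⟩
    · obtain ⟨s', hs', p, hp, y, hy, h⟩ := hs
      have hy' : algebraMap S F (s' * s - p) = y := by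
        rw [map_sub, map_mul, h]; ring
      have := P.asIdeal.add_mem (hNP _ (hy' ▸ hy)) hp
      rw [sub_add_cancel] at this
      exact (P.2.mem_or_mem this).resolve_left hs'

/-- The quotients `p / s` with `p ∈ P`, `s ∉ P` and `P` in `C`. -/
def chainQuotients {S : Type*} (F : Type*) [CommRing S] [Field F] [Algebra S F]
    (C : Set (PrimeSpectrum S)) : Set F :=
  {x | ∃ P ∈ C, ∃ p ∈ P.asIdeal, ∃ s ∉ P.asIdeal, x = algebraMap S F p / algebraMap S F s}

/-- An element of the adjoined algebra involves only finitely many primes, which reduces to the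
finite case. This makes the algebra a proper ideal of its sum with `S`. -/
theorem one_notMem_adjoin_chainQuotients {S F : Type*} [CommRing S] [IsDomain S] [Field F]
    [Algebra S F] [IsFractionRing S F] (C : Set (PrimeSpectrum S)) (hC : IsChain (· ≤ ·) C) :
    (1 : F) ∉ NonUnitalAlgebra.adjoin S (chainQuotients F C) := by
  classical
  have key : ∀ x ∈ NonUnitalAlgebra.adjoin S (chainQuotients F C),
      ∃ t : Finset (PrimeSpectrum S), (t : Set (PrimeSpectrum S)) ⊆ C ∧
        x ∈ NonUnitalAlgebra.adjoin S (chainQuotients F (t : Set (PrimeSpectrum S))) := by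
    have mono : ∀ t t' : Finset (PrimeSpectrum S), t ⊆ t' →
        NonUnitalAlgebra.adjoin S (chainQuotients F (t : Set (PrimeSpectrum S))) ≤
        NonUnitalAlgebra.adjoin S (chainQuotients F (t' : Set (PrimeSpectrum S))) := by
      intro t t' h
      refine NonUnitalAlgebra.adjoin_mono ?_
      rintro x ⟨P, hP, hx⟩
      exact ⟨P, h hP, hx⟩
    intro x hx
    induction hx using NonUnitalAlgebra.adjoin_induction with
    | mem x hx =>
      obtain ⟨P, hP, hx⟩ := hx
      exact ⟨{P}, by simpa using hP, NonUnitalAlgebra.subset_adjoin S ⟨P, by simp, hx⟩⟩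
    | zero => exact ⟨∅, by simp, zero_mem _⟩
    | add x y _ _ hx hy =>
      obtain ⟨t, ht, hx⟩ := hx
      obtain ⟨t', ht', hy⟩ := hy
      exact ⟨t ∪ t', by simp [ht, ht'], add_mem (mono _ _ Finset.subset_union_left hx)
        (mono _ _ Finset.subset_union_right hy)⟩
    | mul x y _ _ hx hy =>
      obtain ⟨t, ht, hx⟩ := hx
      obtain ⟨t', ht', hy⟩ := hy
      exact ⟨t ∪ t', by simp [ht, ht'], mul_mem (mono _ _ Finset.subset_union_left hx)
        (mono _ _ Finset.subset_union_right hy)⟩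
    | smul r x _ hx =>
      obtain ⟨t, ht, hx⟩ := hx
      exact ⟨t, ht, SMulMemClass.smul_mem r hx⟩
  intro h
  obtain ⟨t, htC, ht⟩ := key 1 h
  obtain ⟨N, hN, hNS⟩ := exists_nonUnitalSubalgebra_of_finset (F := F) t (hC.mono htC)
  have hle : NonUnitalAlgebra.adjoin S (chainQuotients F (t : Set (PrimeSpectrum S))) ≤ N := by
    refine NonUnitalAlgebra.adjoin_le ?_
    rintro _ ⟨P, hP, p, hp, s, hs, rfl⟩
    exact hN P hP p hp s hs
  rcases hNS 1 (by rw [map_one]; exact hle ht) with h | ⟨P, -, h⟩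
  · exact one_ne_zero h
  · exact P.asIdeal.ne_top_iff_one.1 P.2.ne_top h

/-- A chain of primes of `S` lifts to a valuation ring: some valuation ring of `F` containing `S`
has every quotient `p / s` in its maximal ideal. -/
theorem exists_valuationSubring_of_chain {S F : Type*} [CommRing S] [IsDomain S] [Field F]
    [Algebra S F] [IsFractionRing S F] (C : Set (PrimeSpectrum S)) (hC : IsChain (· ≤ ·) C) :
    ∃ V : ValuationSubring F, (∀ s : S, algebraMap S F s ∈ V) ∧
      chainQuotients F C ⊆ V.nonunits := by
  let N := NonUnitalAlgebra.adjoin S (chainQuotients F C)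
  let A : Subring F :=
    { carrier := {y | ∃ s : S, y - algebraMap S F s ∈ N}
      zero_mem' := ⟨0, by simp [zero_mem]⟩
      one_mem' := ⟨1, by simp [zero_mem]⟩
      add_mem' := by
        rintro x y ⟨s, hs⟩ ⟨t, ht⟩
        refine ⟨s + t, ?_⟩
        convert add_mem hs ht using 1
        rw [map_add]; ring
      neg_mem' := by
        rintro x ⟨s, hs⟩
        refine ⟨-s, ?_⟩
        convert neg_mem hs using 1
        rw [map_neg]; ring
      mul_mem' := by
        rintro x y ⟨s, hs⟩ ⟨t, ht⟩
        refine ⟨s * t, ?_⟩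
        convert add_mem (add_mem (mul_mem hs ht) (N.smul_mem s ht)) (N.smul_mem t hs) using 1
        rw [Algebra.smul_def, Algebra.smul_def, map_mul]; ring }
  let I : Ideal A :=
    { carrier := {a | a.1 ∈ N}
      zero_mem' := N.zero_mem
      add_mem' := fun ha hb => N.add_mem ha hb
      smul_mem' := by
        rintro ⟨x, s, hs⟩ ⟨y, hyA⟩ hy
        change x * y ∈ N
        convert add_mem (mul_mem hs hy) (N.smul_mem s hy) using 1
        rw [Algebra.smul_def]; ring }
  have hI : I ≠ ⊤ := by
    rw [Ideal.ne_top_iff_one]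
    exact one_notMem_adjoin_chainQuotients C hC
  obtain ⟨V, hAV, hV⟩ := Ideal.image_subset_nonunits_valuationSubring I hI
  refine ⟨V, fun s => hAV ⟨s, by simp [zero_mem]⟩, fun x hx => ?_⟩
  have hxN : x ∈ N := NonUnitalAlgebra.subset_adjoin S hx
  exact hV ⟨⟨x, 0, by simpa using hxN⟩, hxN, rfl⟩

/-- Elements of `P V` are multiples of a single `p ∈ P`. An equation `s = p * y` with `s ∉ P` would
make the nonunit `p / s` invertible, so `P V` misses `S \ P`, and a prime containing `P V` can be
chosen to miss it too. -/
theorem exists_prime_over_of_chainQuotients {S F : Type*} [CommRing S] [IsDomain S] [Field F]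
    [Algebra S F] [IsFractionRing S F] (C : Set (PrimeSpectrum S)) (V : ValuationSubring F)
    (hSV : ∀ s : S, algebraMap S F s ∈ V) (hV : chainQuotients F C ⊆ V.nonunits)
    (P : PrimeSpectrum S) (hP : P ∈ C) :
    ∃ Q : PrimeSpectrum V, ∀ s : S, (⟨algebraMap S F s, hSV s⟩ : V) ∈ Q.asIdeal ↔
      s ∈ P.asIdeal := by
  let φ : S →+* V := (algebraMap S F).codRestrict V.toSubring hSV
  have hφ : ∀ x ∈ P.asIdeal.map φ, ∃ p ∈ P.asIdeal, φ p ∣ x := by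
    intro x hx
    refine Submodule.span_induction ?_ ?_ ?_ ?_ hx
    · rintro _ ⟨p, hp, rfl⟩
      exact ⟨p, hp, dvd_rfl⟩
    · exact ⟨0, P.asIdeal.zero_mem, by simp⟩
    · rintro x y _ _ ⟨p, hp, hx⟩ ⟨q, hq, hy⟩
      rcases ValuationRing.dvd_total (φ p) (φ q) with h | h
      · exact ⟨p, hp, dvd_add hx (h.trans hy)⟩
      · exact ⟨q, hq, dvd_add (h.trans hx) hy⟩
    · rintro a x _ ⟨p, hp, hx⟩
      exact ⟨p, hp, hx.mul_left a⟩
  obtain ⟨Q, hQ, hle, hdisj⟩ := Ideal.exists_le_prime_disjoint (P.asIdeal.map φ)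
    (P.asIdeal.primeCompl.map φ) (by
      rw [Set.disjoint_left]
      rintro x hx ⟨s, hs, rfl⟩
      obtain ⟨p, hp, y, hy⟩ := hφ _ hx
      have hs0 : algebraMap S F s ≠ 0 := by
        rw [Ne, map_eq_zero_iff _ (IsFractionRing.injective S F)]
        rintro rfl
        exact hs P.asIdeal.zero_mem
      have hy' : algebraMap S F s = algebraMap S F p * y := congrArg Subtype.val hy
      have hmem : algebraMap S F p / algebraMap S F s ∈ V.nonunits :=
        hV ⟨P, hP, p, hp, s, hs, rfl⟩
      rw [ValuationSubring.mem_nonunits_iff] at hmem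
      have h1 : V.valuation (algebraMap S F p / algebraMap S F s * y) = 1 := by
        rw [div_mul_eq_mul_div, ← hy', div_self hs0, map_one]
      rw [map_mul] at h1
      exact absurd h1 (mul_lt_one_of_lt_of_le hmem (V.valuation_le_one y)).ne)
  refine ⟨⟨Q, hQ⟩, fun s => ⟨fun hs => ?_, fun hs => hle (Ideal.mem_map_of_mem φ hs)⟩⟩
  by_contra hsP
  exact Set.disjoint_left.1 hdisj hs ⟨s, hsP, rfl⟩

/-! ### Orders preserving a lattice. -/

/-- The elements of `A` whose coordinates in the basis `b` lie in `V`. -/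
def coordLattice {ι F A : Type*} [Field F] [Ring A] [Algebra F A] (b : Module.Basis ι F A)
    (V : ValuationSubring F) : AddSubgroup A where
  carrier := {x | ∀ i, b.repr x i ∈ V}
  zero_mem' i := by simp [zero_mem]
  add_mem' hx hy i := by simpa using add_mem (hx i) (hy i)
  neg_mem' hx i := by simpa using neg_mem (hx i)

section

variable {ι S F A : Type*} [CommRing S] [Field F] [Algebra S F] [Ring A] [Algebra F A]
  [Algebra S A] [IsScalarTower S F A] {b : Module.Basis ι F A} {V : ValuationSubring F}

theorem smul_mem_coordLattice {a : F} (ha : a ∈ V) {x : A} (hx : x ∈ coordLattice b V) :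
    a • x ∈ coordLattice b V := fun i => by
  simpa using mul_mem ha (hx i)

theorem basis_mem_coordLattice (i : ι) : b i ∈ coordLattice b V := fun j => by
  classical
  rw [b.repr_self, Finsupp.single_apply]
  split_ifs
  · exact one_mem _
  · exact zero_mem _

/-- `V`-subalgebras of `A` that span `A` over `F` and preserve the lattice of `b`. -/
structure IsLatticeOrder (b : Module.Basis ι F A) (V : ValuationSubring F)
    (R : Subalgebra S A) : Prop where
  algebraMap_mem : ∀ x ∈ V, algebraMap F A x ∈ R
  mul_mem_lattice : ∀ a ∈ R, ∀ x ∈ coordLattice b V, a * x ∈ coordLattice b V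
  span_eq_top : Submodule.span F (R : Set A) = ⊤

/-- The order is the left multiplier ring of the lattice; stability of the basis says exactly that
`C` multiplies basis vectors into the lattice. -/
theorem exists_isLatticeOrder (hSV : ∀ s : S, algebraMap S F s ∈ V) (C : Set A)
    (hC : Submodule.span F C = ⊤)
    (hCb : ∀ c ∈ C, ∀ i, c * b i ∈ Submodule.span S (Set.range b)) :
    ∃ R : Subalgebra S A, IsLatticeOrder b V R := by
  have hV : ∀ x ∈ V, ∀ y ∈ coordLattice b V, algebraMap F A x * y ∈ coordLattice b V := by
    intro x hx y hy
    rw [← Algebra.smul_def]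
    exact smul_mem_coordLattice hx hy
  have hspan : ∀ x ∈ Submodule.span S (Set.range b), x ∈ coordLattice b V := by
    intro x hx
    refine Submodule.span_induction ?_ (zero_mem _) (fun _ _ _ _ => add_mem) ?_ hx
    · rintro _ ⟨i, rfl⟩
      exact basis_mem_coordLattice i
    · intro s x _ hx
      rw [← IsScalarTower.algebraMap_smul F s x]
      exact smul_mem_coordLattice (hSV s) hx
  let R : Subalgebra S A :=
    { carrier := {a | ∀ x ∈ coordLattice b V, a * x ∈ coordLattice b V}
      mul_mem' := fun ha hb x hx => by rw [mul_assoc]; exact ha _ (hb x hx)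
      add_mem' := fun ha hb x hx => by rw [add_mul]; exact add_mem (ha x hx) (hb x hx)
      algebraMap_mem' := fun s x hx => by
        rw [IsScalarTower.algebraMap_apply S F A]
        exact hV _ (hSV s) x hx }
  have hCR : C ⊆ R := by
    intro c hc x hx
    rw [← b.linearCombination_repr x, Finsupp.linearCombination_apply, Finsupp.mul_sum]
    refine sum_mem fun i _ => ?_
    beta_reduce
    rw [mul_smul_comm]
    exact smul_mem_coordLattice (hx i) (hspan _ (hCb c hc i))
  exact ⟨R, hV, fun a ha => ha, top_le_iff.1 (hC ▸ Submodule.span_mono hCR)⟩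

/-- The smaller order is `R ∩ (V + (t / σ) L)`, with `L` the lattice and `t` so divisible that a
chosen `a ∈ R` outside `F` is excluded. -/
theorem IsLatticeOrder.exists_lt (hA : ¬ Function.Surjective (algebraMap F A))
    (hSV : ∀ s : S, algebraMap S F s ∈ V)
    {π : F} (hπ : π ∈ V.nonunits) (hπ0 : π ≠ 0) {R : Subalgebra S A}
    (hR : IsLatticeOrder b V R) : ∃ R' < R, IsLatticeOrder b V R' := by
  obtain ⟨a, haR, ha⟩ : ∃ a ∈ R, ∀ x : F, algebraMap F A x ≠ a := by
    by_contra! hcon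
    refine hA fun y => ?_
    have hy : y ∈ Submodule.span F (R : Set A) := hR.span_eq_top ▸ Submodule.mem_top
    have hle : Submodule.span F (R : Set A) ≤ Subalgebra.toSubmodule (⊥ : Subalgebra F A) := by
      rw [Submodule.span_le]
      intro r hr
      obtain ⟨x, hx⟩ := hcon r hr
      exact Algebra.mem_bot.2 ⟨x, hx⟩
    exact Algebra.mem_bot.1 (hle hy)
  have hA1 : (1 : A) ≠ 0 := by
    intro h
    exact ha 0 (by rw [map_zero, ← mul_one a, h, mul_zero])
  -- The lattice need not contain `1`; `σ` clears the finitely many denominators of its coordinates.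
  obtain ⟨σ, hσ0, hσ⟩ : ∃ σ : F, σ ≠ 0 ∧ algebraMap F A σ ∈ coordLattice b V := by
    classical
    have hfin : ∀ t : Finset ι, ∃ σ : F, σ ≠ 0 ∧ σ ∈ V ∧ ∀ i ∈ t, σ * b.repr 1 i ∈ V := by
      intro t
      induction t using Finset.induction_on with
      | empty => exact ⟨1, one_ne_zero, one_mem _, by simp⟩
      | insert i t _ ih =>
        obtain ⟨σ, h0, hσ, h⟩ := ih
        by_cases hi : b.repr 1 i ∈ V
        · refine ⟨σ, h0, hσ, fun j hj => ?_⟩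
          rcases Finset.mem_insert.1 hj with rfl | hj
          · exact mul_mem hσ hi
          · exact h j hj
        · have hi0 : b.repr 1 i ≠ 0 := fun h => hi (h ▸ zero_mem _)
          have hinv := (V.mem_or_inv_mem (b.repr 1 i)).resolve_left hi
          refine ⟨σ * (b.repr 1 i)⁻¹, mul_ne_zero h0 (inv_ne_zero hi0), mul_mem hσ hinv,
            fun j hj => ?_⟩
          rcases Finset.mem_insert.1 hj with rfl | hj
          · rwa [mul_assoc, inv_mul_cancel₀ hi0, mul_one]
          · rw [mul_right_comm]
            exact mul_mem (h j hj) hinv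
    obtain ⟨σ, h0, -, h⟩ := hfin (b.repr 1).support
    refine ⟨σ, h0, fun i => ?_⟩
    rw [Algebra.algebraMap_eq_smul_one, map_smul, Finsupp.smul_apply, smul_eq_mul]
    by_cases hi : b.repr 1 i = 0
    · rw [hi, mul_zero]; exact zero_mem _
    · exact h i (Finsupp.mem_support_iff.2 hi)
  let e := b.repr (1 : A)
  obtain ⟨i, hi⟩ : ∃ i, e i ≠ 0 := by
    by_contra! hcon
    exact hA1 (b.repr.map_eq_zero_iff.1 (Finsupp.ext hcon))
  -- A nonzero 2×2 minor of the coordinates of `a` and `1` witnesses `a ∉ F`; such minors do not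
  -- change when a scalar is subtracted from `a`.
  obtain ⟨j, hj⟩ : ∃ j, b.repr a j * e i - b.repr a i * e j ≠ 0 := by
    by_contra! hcon
    refine ha (b.repr a i / e i) (b.repr.injective (Finsupp.ext fun j => ?_))
    rw [Algebra.algebraMap_eq_smul_one, map_smul, Finsupp.smul_apply, smul_eq_mul]
    change b.repr a i / e i * e j = _
    have := hcon j
    field_simp
    linear_combination -this
  set w := b.repr a j * e i - b.repr a i * e j with hw
  have hσe : ∀ k, σ * e k ∈ V := by
    intro k
    have := hσ k
    rwa [Algebra.algebraMap_eq_smul_one, map_smul, Finsupp.smul_apply, smul_eq_mul] at this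
  have hσa : ∀ k, σ * b.repr a k ∈ V := by
    intro k
    have := hR.mul_mem_lattice a haR _ hσ k
    rwa [← Algebra.commutes, ← Algebra.smul_def, map_smul, Finsupp.smul_apply,
      smul_eq_mul] at this
  have hwV : σ ^ 2 * w ∈ V := by
    have := sub_mem (mul_mem (hσa j) (hσe i)) (mul_mem (hσa i) (hσe j))
    convert this using 1
    rw [hw]; ring
  have hπV : π ∈ V := V.nonunits_subset hπ
  let t := π * (σ ^ 2 * w)
  have ht0 : t ≠ 0 := mul_ne_zero hπ0 (mul_ne_zero (pow_ne_zero 2 hσ0) hj)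
  have htV : t ∈ V := mul_mem hπV hwV
  -- Closure under products rests on `r r' - o o' = r (r' - o') + o' (r - o)` and `r L ⊆ L`.
  let R' : Subalgebra S A :=
    { carrier := {r | r ∈ R ∧ ∃ o ∈ V, ∃ x ∈ coordLattice b V,
        σ • (r - algebraMap F A o) = t • x}
      mul_mem' := by
        rintro r r' ⟨hr, o, ho, x, hx, h⟩ ⟨hr', o', ho', x', hx', h'⟩
        refine ⟨R.mul_mem hr hr', o * o', mul_mem ho ho', r * x' + o' • x,
          add_mem (hR.mul_mem_lattice r hr x' hx') (smul_mem_coordLattice ho' hx), ?_⟩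
        have h1 : r * r' - algebraMap F A (o * o') =
            r * (r' - algebraMap F A o') + o' • (r - algebraMap F A o) := by
          rw [Algebra.smul_def, mul_sub, mul_sub, Algebra.commutes o' r, mul_comm o o', map_mul]
          abel
        rw [h1, smul_add, ← mul_smul_comm, h', smul_comm σ o', h, smul_add, mul_smul_comm,
          smul_comm t o']
      add_mem' := by
        rintro r r' ⟨hr, o, ho, x, hx, h⟩ ⟨hr', o', ho', x', hx', h'⟩
        refine ⟨R.add_mem hr hr', o + o', add_mem ho ho', x + x', add_mem hx hx', ?_⟩
        rw [smul_add, ← h, ← h', ← smul_add, map_add]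
        congr 1
        abel
      algebraMap_mem' := fun s => ⟨R.algebraMap_mem s, algebraMap S F s, hSV s, 0, zero_mem _, by
        rw [← IsScalarTower.algebraMap_apply S F A, sub_self, smul_zero, smul_zero]⟩ }
  have hle : R' ≤ R := fun r hr => hr.1
  refine ⟨R', lt_of_le_of_ne hle ?_, ?_, fun r hr => hR.mul_mem_lattice r (hle hr), ?_⟩
  · intro heq
    obtain ⟨-, o, ho, x, hx, h⟩ : a ∈ R' := heq ▸ haR
    have hcoord : ∀ k, σ * (b.repr a k - o * e k) = t * b.repr x k := by
      intro k
      have := congrArg (fun y => b.repr y k) h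
      simpa only [Algebra.algebraMap_eq_smul_one, map_smul, map_sub, Finsupp.smul_apply,
        Finsupp.sub_apply, smul_eq_mul] using this
    have hy : b.repr x j * (σ * e i) - b.repr x i * (σ * e j) ∈ V :=
      sub_mem (mul_mem (hx j) (hσe i)) (mul_mem (hx i) (hσe j))
    set y := b.repr x j * (σ * e i) - b.repr x i * (σ * e j) with hy_def
    -- Taking the minor of `σ (a - o) = t x` against `σ · 1` eliminates `o` and gives `σ² w = t y`.
    -- Since `t = π σ² w`, the nonunit `π` would have inverse `y ∈ V`.
    have h1 : σ ^ 2 * w * (π * y) = σ ^ 2 * w * 1 := by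
      have hty : t * y = σ ^ 2 * w := by
        rw [hy_def, hw]
        linear_combination -(σ * e i) * hcoord j + (σ * e j) * hcoord i
      rw [mul_one]
      nth_rewrite 2 [← hty]
      ring
    have h2 := mul_left_cancel₀ (mul_ne_zero (pow_ne_zero 2 hσ0) hj) h1
    have h3 := congrArg V.valuation h2
    rw [map_mul, map_one] at h3
    exact absurd h3 (mul_lt_one_of_lt_of_le (V.mem_nonunits_iff.1 hπ)
      ((V.valuation_le_one_iff y).2 hy)).ne
  · intro v hv
    exact ⟨hR.algebraMap_mem v hv, v, hv, 0, zero_mem _, by simp⟩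
  · rw [eq_top_iff, ← hR.span_eq_top, Submodule.span_le]
    intro r hr
    -- `t R ⊆ R'` with `t ≠ 0`, so the span over `F` is unchanged.
    have hmem : t • r ∈ R' := by
      refine ⟨?_, 0, zero_mem _, r * algebraMap F A σ, hR.mul_mem_lattice r hr _ hσ, ?_⟩
      · rw [Algebra.smul_def]
        exact R.mul_mem (hR.algebraMap_mem t htV) hr
      · rw [map_zero, sub_zero, ← Algebra.commutes, ← Algebra.smul_def, smul_comm]
    have := Submodule.smul_mem _ t⁻¹ (Submodule.subset_span (R := F) hmem)
    rwa [smul_smul, inv_mul_cancel₀ ht0, one_smul] at this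

/-- If `1 = a • r` with `a` a nonunit of `V`, then `b i = a • (r * b i)`, and the `i`-th coordinate
makes `a` a unit. Hence the maximal ideal of `V` generates a proper ideal of `R`. -/
theorem IsLatticeOrder.hasCoveringChain [IsDomain S] [IsFractionRing S F] [Nonempty ι]
    {C : Set (PrimeSpectrum S)} (hSV : ∀ s : S, algebraMap S F s ∈ V)
    (hV : chainQuotients F C ⊆ V.nonunits) {R : Subalgebra S A} (hR : IsLatticeOrder b V R) :
    HasCoveringChain R C := by
  have hinj : Function.Injective (algebraMap F A) := by
    have : Nontrivial A := ⟨b (Classical.arbitrary ι), 0, b.ne_zero _⟩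
    exact (algebraMap F A).injective
  let φ : V →+* R := ((algebraMap F A).comp V.subtype).codRestrict R
    fun x => hR.algebraMap_mem x x.2
  let : Algebra V R := φ.toAlgebra' fun c x => Subtype.ext (Algebra.commutes (c : F) (x : A))
  have hsmul : ∀ (s : V) (r : R), ((s • r : R) : A) = (s : F) • (r : A) := by
    intro s r
    rw [Algebra.smul_def, Algebra.smul_def]
    rfl
  let m : TwoSidedIdeal R := .mk' {r | ∃ a : V, ¬ IsUnit a ∧ ∃ r' : R, r = a • r'}
    ⟨0, not_isUnit_zero, 0, by simp⟩
    (by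
      rintro _ _ ⟨a, ha, r, rfl⟩ ⟨a', ha', r', rfl⟩
      rcases ValuationRing.dvd_total a a' with ⟨q, rfl⟩ | ⟨q, rfl⟩
      · exact ⟨a, ha, r + q • r', by rw [smul_add, mul_smul]⟩
      · exact ⟨a', ha', q • r + r', by rw [smul_add, mul_smul]⟩)
    (by rintro _ ⟨a, ha, r, rfl⟩; exact ⟨a, ha, -r, by rw [smul_neg]⟩)
    (by rintro x _ ⟨a, ha, r, rfl⟩; exact ⟨a, ha, x * r, by rw [mul_smul_comm]⟩)
    (by rintro _ x ⟨a, ha, r, rfl⟩; exact ⟨a, ha, r * x, by rw [smul_mul_assoc]⟩)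
  have hm : m ≠ ⊤ := by
    rw [Ne, ← TwoSidedIdeal.one_mem_iff, TwoSidedIdeal.mem_mk']
    rintro ⟨a, ha, r, h⟩
    let i := Classical.arbitrary ι
    have h1 : (1 : A) = (a : F) • (r : A) := by rw [← hsmul, ← h]; rfl
    have h2 : b i = (a : F) • ((r : A) * b i) := by rw [← smul_mul_assoc, ← h1, one_mul]
    have h3 := congrArg (fun y => b.repr y i) h2
    simp only [b.repr_self, Finsupp.single_eq_same, map_smul, Finsupp.smul_apply,
      smul_eq_mul] at h3
    exact ha (.of_mul_eq_one
      ⟨_, hR.mul_mem_lattice r r.2 _ (basis_mem_coordLattice i) i⟩ (Subtype.ext h3.symm))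
  obtain ⟨E, hE, hEp, hEc⟩ := exists_chain_over_valuationRing (O := V) (R := R)
    (by
      intro s r h
      have h' := congrArg Subtype.val h
      rw [hsmul] at h'
      rcases smul_eq_zero.1 h' with h | h
      · exact Or.inl (Subtype.ext h)
      · exact Or.inr (Subtype.ext h))
    m hm
    (by
      intro a ha
      rw [TwoSidedIdeal.mem_mk']
      exact ⟨a, ha, 1, by rw [Algebra.smul_def, mul_one]⟩)
  refine ⟨E, hE, hEp, fun P hP => ?_⟩
  obtain ⟨Q', hQ'⟩ := exists_prime_over_of_chainQuotients C V hSV hV P hP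
  obtain ⟨Q, hQ, hQQ'⟩ := hEc Q'
  refine ⟨Q, hQ, fun s => ?_⟩
  rw [← hQ', ← hQQ']
  have : algebraMap S R s = algebraMap V R ⟨algebraMap S F s, hSV s⟩ :=
    Subtype.ext (IsScalarTower.algebraMap_apply S F A s)
  rw [this]

end

/-! ### Conclusion. -/

/-- A nonzero prime in the chain supplies the nonzero nonunit of `V` needed for the descent;
otherwise `V` could be `F` itself. -/
theorem exists_chain_with_ne_bot {S : Type*} [CommRing S] [IsDomain S] (hS : ¬ IsField S)
    (C : Set (PrimeSpectrum S)) (hC : IsChain (· ≤ ·) C) :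
    ∃ C' : Set (PrimeSpectrum S), C ⊆ C' ∧ IsChain (· ≤ ·) C' ∧ ∃ P ∈ C', P.asIdeal ≠ ⊥ := by
  by_cases h : ∃ P ∈ C, P.asIdeal ≠ ⊥
  · exact ⟨C, subset_rfl, hC, h⟩
  · push Not at h
    obtain ⟨m, hm⟩ := Ideal.exists_maximal S
    refine ⟨insert ⟨m, hm.isPrime⟩ C, Set.subset_insert _ _, hC.insert fun P hP _ => Or.inr ?_,
      _, Set.mem_insert _ _, Ring.ne_bot_of_isMaximal_of_not_isField hm hS⟩
    rw [← PrimeSpectrum.asIdeal_le_asIdeal, h P hP]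
    exact bot_le

end StableBasis

theorem mainTheorem6
    {S : Type*} [CommRing S] [IsDomain S] (hS : ¬ IsField S)
    {F : Type*} [Field F] [Algebra S F] [IsFractionRing S F]
    {A : Type*} [Ring A] [Algebra F A] [Algebra S A] [IsScalarTower S F A]
    (hA : ¬ Function.Surjective (algebraMap F A))
    (hB : ∃ B : Set A, StableBasis.IsStableBasis S F B)
    (C : Set (PrimeSpectrum S)) (hC : IsChain (· ≤ ·) C) :
    (∃ R : Subalgebra S A,
      Submodule.span F (R : Set A) = ⊤ ∧ StableBasis.HasCoveringChain R C) ∧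
    (∃ R : ℕ → Subalgebra S A, StrictAnti R ∧
      ∀ n, Submodule.span F (R n : Set A) = ⊤ ∧ StableBasis.HasCoveringChain (R n) C) := by
  obtain ⟨B, ⟨hBli, hBtop⟩, D, ⟨-, hDtop⟩, hDB⟩ := hB
  obtain ⟨C', hCC', hC', P, hP, hPbot⟩ := StableBasis.exists_chain_with_ne_bot hS C hC
  obtain ⟨p, hp, hp0⟩ := Submodule.exists_mem_ne_zero_of_ne_bot hPbot
  obtain ⟨V, hSV, hV⟩ := StableBasis.exists_valuationSubring_of_chain (F := F) C' hC'
  have hπ : algebraMap S F p ∈ V.nonunits :=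
    hV ⟨P, hP, p, hp, 1, P.asIdeal.ne_top_iff_one.1 P.2.ne_top, by simp⟩
  have hπ0 : algebraMap S F p ≠ 0 := by
    rwa [Ne, map_eq_zero_iff _ (IsFractionRing.injective S F)]
  let b : Module.Basis B F A := .mk (v := ((↑) : B → A)) hBli (by simp [hBtop])
  have hb : ∀ i, b i = i := fun i => Module.Basis.mk_apply _ _ i
  have hrange : Set.range b = B := by
    rw [funext hb, Subtype.range_coe]
  have : Nonempty B := by
    by_contra hempty
    rw [not_nonempty_iff] at hempty
    have := b.repr.toEquiv.subsingleton
    exact hA fun y => ⟨0, Subsingleton.elim _ _⟩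
  obtain ⟨R₀, hR₀⟩ := StableBasis.exists_isLatticeOrder (b := b) (V := V) hSV D hDtop
    (fun c hc i => by rw [hrange, hb]; exact hDB c hc i i.2)
  have good : ∀ R : Subalgebra S A, StableBasis.IsLatticeOrder b V R →
      Submodule.span F (R : Set A) = ⊤ ∧ StableBasis.HasCoveringChain R C := by
    intro R hR
    obtain ⟨E, hE, hEp, hEc⟩ := hR.hasCoveringChain hSV hV
    exact ⟨hR.span_eq_top, E, hE, hEp, fun P hP => hEc P (hCC' hP)⟩
  refine ⟨⟨R₀, good R₀ hR₀⟩, ?_⟩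
  have : Nonempty {R : Subalgebra S A // StableBasis.IsLatticeOrder b V R} := ⟨⟨R₀, hR₀⟩⟩
  have : NoMinOrder {R : Subalgebra S A // StableBasis.IsLatticeOrder b V R} :=
    ⟨fun R => by
      obtain ⟨R', hlt, hR'⟩ := R.2.exists_lt hA hSV hπ hπ0
      exact ⟨⟨R', hR'⟩, hlt⟩⟩
  obtain ⟨f, hf⟩ := Nat.exists_strictAnti {R : Subalgebra S A // StableBasis.IsLatticeOrder b V R}
  exact ⟨fun n => f n, fun _ _ h => hf h, fun n => good _ (f n).2⟩
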